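/- Let $\mathcal M\subset\mathbb R^d$ be a compact, boundaryless, embedded $C^4$ submanifold of dimension $n$. A local parametrization of $\mathcal M$ is a $C^4$ injective immersion $\Phi:U\to\mathbb R^d$, with $U\subset\mathbb R^n$ open, that is a homeomorphism onto a relatively open subset of $\mathcal M$; an atlas is a set of local parametrizations whose images cover $\mathcal M$. For $u\in U$ and $x\in\mathbb R^d$ let $\hat H_\Phi(u,x)$ be the $n\times n$ matrix $$\hat H_\Phi(u,x)_{ij}=\Big\langle \tfrac{\partial^2\Phi(u)}{\partial u_i\partial u_j},\,\Phi(u)-x\Big\rangle+\Big\langle\tfrac{\partial\Phi(u)}{\partial u_i},\tfrac{\partial\Phi(u)}{\partial u_j}\Big\rangle .$$ For a probability measure $\mu$ on $\mathbb R^d$ and $\sigma>0$ put $$p_\sigma(x)=\int \frac{1}{(2\pi\sigma^2)^{d/2}}\exp\Big(-\frac{\|x-\gamma(\sigma)y\|^2}{2\sigma^2}\Big)\,d\mu(y),$$ written $p^{\mathrm{VE}}_\sigma$ if $\gamma(\sigma)=1$ (variance exploding) and $p^{\mathrm{VP}}_\sigma$ if $\gamma(\sigma)=\sqrt{1-\sigma^2}$,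 $0<\sigma<1$ (variance preserving). **Theorem.** There is an $\varepsilon>0$, depending only on $\mathcal M$, such that every $x\in T_{\mathcal M}(\varepsilon)=\{x\in\mathbb R^d:\operatorname{dist}(x,\mathcal M)<\varepsilon\}$ has a unique nearest point $P_{\mathcal M}(x)$ in $\mathcal M$; such that $\det\hat H_\Phi(u,x)>0$ whenever $x\in T_{\mathcal M}(\varepsilon)$, $\Phi:U\to\mathcal M$ is a local parametrization and $u\in U$ satisfies $\Phi(u)=P_{\mathcal M}(x)$; and such that the following holds. Let $\mu$ be a probability measure with $\mu(\mathbb R^d\setminus\mathcal M)=0$, and let $\mathcal A$ be an atlas such that in every $\Phi:U\to\mathcal M$ of $\mathcal A$ the measure $\mu$ has a $C^1$, strictly positive density $p_\Phi:U\to\mathbb R$, i.e. $\mu(\Phi(S))=\int_S p_\Phi(u)\,du$ for all Borel $S\subset U$. Then, as $\sigma\to0^+$, for $x\in T_{\mathcal M}(\varepsilon)$, $\Phi:U\to\mathcal M$ in $\mathcal A$ and $u\in U$ with $\Phi(u)=P_{\mathcal M}(x)$, $p^{\mathrm{VE}}_\sigma(x)$ and $p^{\mathrm{VP}}_\sigma(x)$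 are positive and $$\log p^{\mathrm{VE}}_\sigma(x)=-\frac{\|x-P_{\mathcal M}(x)\|^2}{2\sigma^2}+\log p_\Phi(u)-\frac{d-n}{2}\log(2\pi\sigma^2)-\log\sqrt{|\det\hat H_\Phi(u,x)|}+o(1),$$ $$\log p^{\mathrm{VP}}_\sigma(x)=-\frac{\|x-P_{\mathcal M}(x)\|^2}{2\sigma^2}+\log p_\Phi(u)-\frac{d-n}{2}\log(2\pi\sigma^2)-\log\sqrt{|\det\hat H_\Phi(u,x)|}-\frac12\big\langle P_{\mathcal M}(x),\,x-P_{\mathcal M}(x)\big\rangle+o(1),$$ where the $o(1)$ terms are uniform in $x\in T_{\mathcal M}(\varepsilon)$ and in the choice of $\Phi\in\mathcal A$. -/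

import Mathlib

open MeasureTheory Filter Topology

noncomputable section

/-- `n`-dimensional Euclidean space with the Euclidean norm. -/
abbrev Euc (n : ℕ) : Type := EuclideanSpace ℝ (Fin n)

/-- A `C^4` local parametrization of the subset `M` of `ℝ^d` by `n` parameters: an injective `C^4`
immersion `Φ` of an open set `U` of `ℝ^n` into `M` which is open as a map from `U` to `M`; so `Φ` is
a homeomorphism from `U` onto a relatively open subset of `M`. -/
structure LocalParam (n d : ℕ) (M : Set (Euc d)) where
  /-- the parameter domain -/
  U : Set (Euc n)
  /-- the parametrization; only its values on `U` matter -/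
  Φ : Euc n → Euc d
  isOpen_U : IsOpen U
  contDiffOn : ContDiffOn ℝ 4 Φ U
  injOn : Set.InjOn Φ U
  immersion : ∀ u ∈ U, Function.Injective (fderiv ℝ Φ u)
  mapsTo : Set.MapsTo Φ U M
  open_image : ∀ W ⊆ U, IsOpen W → ∃ V : Set (Euc d), IsOpen V ∧ Φ '' W = M ∩ V

/-- `M` is an `n`-dimensional (boundaryless) embedded `C^4` submanifold of `ℝ^d`: every point of `M`
lies in the image of a `C^4` local parametrization. -/
def IsC4Submanifold (n d : ℕ) (M : Set (Euc d)) : Prop :=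
  ∀ y ∈ M, ∃ c : LocalParam n d M, y ∈ c.Φ '' c.U

/-- A set of local parametrizations whose images cover `M`. -/
def IsAtlas {n d : ℕ} {M : Set (Euc d)} (A : Set (LocalParam n d M)) : Prop :=
  ∀ y ∈ M, ∃ c ∈ A, y ∈ c.Φ '' c.U

/-- `p` is a `C^1`, strictly positive density on `U`, with respect to Lebesgue measure, of the
measure `μ` read in the local parametrization `c`. -/
structure IsC1PosDensity {n d : ℕ} {M : Set (Euc d)} (μ : Measure (Euc d)) (c : LocalParam n d M)
    (p : Euc n → ℝ) : Prop where
  contDiffOn : ContDiffOn ℝ 1 p c.U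
  pos : ∀ u ∈ c.U, 0 < p u
  density : ∀ S ⊆ c.U, MeasurableSet S → μ (c.Φ '' S) = ∫⁻ u in S, ENNReal.ofReal (p u)

/-- `y` is a point of `M` closest to `x`. -/
def IsNearestPoint {d : ℕ} (M : Set (Euc d)) (x y : Euc d) : Prop :=
  y ∈ M ∧ ∀ z ∈ M, ‖x - y‖ ≤ ‖x - z‖

/-- The Lebesgue density at `x` of `γ X + σ Z`, where `X` has law `μ` and `Z` is an independent
standard Gaussian vector of `ℝ^d`. -/
def smoothedDensity {d : ℕ} (μ : Measure (Euc d)) (γ σ : ℝ) (x : Euc d) : ℝ :=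
  ∫ y, 1 / (2 * Real.pi * σ ^ 2) ^ ((d : ℝ) / 2) * Real.exp (-‖x - γ • y‖ ^ 2 / (2 * σ ^ 2)) ∂μ

/-- The variance-exploding smoothing. -/
def densityVE {d : ℕ} (μ : Measure (Euc d)) (σ : ℝ) (x : Euc d) : ℝ :=
  smoothedDensity μ 1 σ x

/-- The variance-preserving smoothing. -/
def densityVP {d : ℕ} (μ : Measure (Euc d)) (σ : ℝ) (x : Euc d) : ℝ :=
  smoothedDensity μ (Real.sqrt (1 - σ ^ 2)) σ x

/-- The `i`-th partial derivative `∂Φ/∂u_i`. -/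
def partialD {n d : ℕ} (Φ : Euc n → Euc d) (i : Fin n) (u : Euc n) : Euc d :=
  fderiv ℝ Φ u (EuclideanSpace.single i 1)

/-- The matrix with entries `⟪∂²Φ/∂u_i∂u_j (u), Φ(u) - x⟫ + ⟪∂Φ/∂u_i (u), ∂Φ/∂u_j (u)⟫`. -/
def hatH {n d : ℕ} (Φ : Euc n → Euc d) (u : Euc n) (x : Euc d) : Matrix (Fin n) (Fin n) ℝ :=
  Matrix.of fun i j =>
    inner ℝ (partialD (partialD Φ j) i u) (Φ u - x) + inner ℝ (partialD Φ i u) (partialD Φ j u)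

end

/-!
The theorem is Laplace's method, made uniform in the base point `x`.

*Geometry.* If `P` is a nearest point of `x` in `M`, then `x - P` is normal to `M`, while `M` leaves
its tangent space at `P` at most quadratically. Hence `|⟪x - P, y - P⟫| ≤ C ‖x - P‖ ‖y - P‖ ^ 2` for
all `y ∈ M`, with `C` independent of `P` by compactness, and for `‖x - P‖ ≤ ε` small the squared
distance grows quadratically: `‖x - y‖ ^ 2 - ‖x - P‖ ^ 2 ≥ ‖y - P‖ ^ 2 / 2` on all of `M`
(`IsC4Submanifold.exists_growth`). This one inequality yields uniqueness of the nearest point,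
continuity of the projection (`tendsto_of_isNearestPoint`), positive definiteness of the matrix
`hatH`, which is half the Hessian of the squared distance (`LocalParam.posDef_hatH`), and the
Gaussian bound which allows dominated convergence.

*Asymptotics.* Expanding `‖x - γ y‖ ^ 2` around `γ = 1`, the density equals
`exp (-‖x - P‖ ^ 2 / (2 σ ^ 2))` times the integral of a kernel in which `γ` enters only through
`(1 - γ) / σ ^ 2`; this quotient is `0` in the variance-exploding case and tends to `1 / 2` in the
variance-preserving one. Away from `P` the kernel is exponentially small. Near `P` the integral is
read in a parametrization and rescaled by `σ` around the parameter of `P`; it converges to a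
Gaussian integral with precision matrix `hatH`. All this holds jointly in `σ → 0⁺` and `x → x₀`
(`LocalParam.tendsto_smoothedDensity`).

*Uniformity.* Joint convergence near every point of the compact closed tube gives uniform
convergence on it. The limit is independent of the parametrization because limits are unique, so
uniformity over the atlas requires no change-of-variables formula.
-/

/-! ### Calculus -/

/-- The Taylor remainder of order two is small compared with `‖w - u‖ ^ 2` uniformly as both points
tend to `u₀`. -/
theorem ContDiffAt.taylor_two_eventually_le {E F : Type*} [NormedAddCommGroup E] [NormedSpace ℝ E]
    [NormedAddCommGroup F] [NormedSpace ℝ F] {f : E → F} {u₀ : E} (hf : ContDiffAt ℝ 2 f u₀)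
    {η : ℝ} (hη : 0 < η) :
    ∀ᶠ q : E × E in 𝓝 (u₀, u₀),
      ‖f q.2 - f q.1 - fderiv ℝ f q.1 (q.2 - q.1) -
        (1 / 2 : ℝ) • fderiv ℝ (fderiv ℝ f) u₀ (q.2 - q.1) (q.2 - q.1)‖ ≤ η * ‖q.2 - q.1‖ ^ 2 := by
  have hD : HasStrictFDerivAt (fderiv ℝ f) (fderiv ℝ (fderiv ℝ f) u₀) u₀ :=
    (hf.fderiv_right (m := 1) (by norm_num)).hasStrictFDerivAt (by norm_num)
  have h1 : ∀ᶠ q : E × E in 𝓝 (u₀, u₀), ‖fderiv ℝ f q.1 - fderiv ℝ f q.2 -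
      fderiv ℝ (fderiv ℝ f) u₀ (q.1 - q.2)‖ ≤ η * ‖q.1 - q.2‖ := hD.isLittleO.def hη
  have h2 : ∀ᶠ u in 𝓝 u₀, DifferentiableAt ℝ f u := by
    filter_upwards [hf.eventually (by norm_num)] with u hu
    exact hu.differentiableAt (by norm_num)
  rw [nhds_prod_eq] at h1 ⊢
  obtain ⟨s, hs, hs'⟩ := eventually_prod_self_iff'.1 h1
  obtain ⟨r, hr, hball⟩ := Metric.eventually_nhds_iff_ball.1
    ((Filter.eventually_mem_set.2 hs).and h2)
  filter_upwards [prod_mem_prod (Metric.ball_mem_nhds u₀ hr) (Metric.ball_mem_nhds u₀ hr)]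
    with ⟨u, w⟩ ⟨hu, hw⟩
  simp only at hu hw ⊢
  set v := w - u with hv
  set A := fderiv ℝ (fderiv ℝ f) u₀
  have hseg : ∀ t ∈ Set.Icc (0 : ℝ) 1, u + t • v ∈ Metric.ball u₀ r := fun t ht =>
    (convex_ball u₀ r).add_smul_sub_mem hu hw ht
  have hder : ∀ t ∈ Set.Icc (0 : ℝ) 1, HasDerivWithinAt
      (fun t : ℝ => f (u + t • v) - f u - t • fderiv ℝ f u v - (t ^ 2 / 2) • A v v)
      (fderiv ℝ f (u + t • v) v - fderiv ℝ f u v - t • A v v) (Set.Icc 0 1) t := by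
    intro t ht
    have a1 : HasDerivAt (fun t : ℝ => u + t • v) v t := by
      simpa using ((hasDerivAt_id t).smul_const v).const_add u
    have a2 := (hball _ (hseg t ht)).2.hasFDerivAt.comp_hasDerivAt t a1
    have a3 : HasDerivAt (fun t : ℝ => t • fderiv ℝ f u v) (fderiv ℝ f u v) t := by
      simpa using (hasDerivAt_id t).smul_const (fderiv ℝ f u v)
    have a4 : HasDerivAt (fun t : ℝ => (t ^ 2 / 2) • A v v) (t • A v v) t := by
      have : HasDerivAt (fun t : ℝ => t ^ 2 / 2) t t := by
        simpa using ((hasDerivAt_id t).pow 2).div_const 2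
      exact this.smul_const _
    exact (((a2.sub_const (f u)).sub a3).sub a4).hasDerivWithinAt
  have hbd : ∀ t ∈ Set.Ico (0 : ℝ) 1,
      ‖fderiv ℝ f (u + t • v) v - fderiv ℝ f u v - t • A v v‖ ≤ η * ‖v‖ ^ 2 := by
    intro t ht
    have ht' := Set.Ico_subset_Icc_self ht
    have h := hs' _ (hball _ (hseg t ht')).1 _ (hball _ hu).1
    simp only [add_sub_cancel_left, map_smul] at h
    calc _ = ‖(fderiv ℝ f (u + t • v) - fderiv ℝ f u - t • A v) v‖ := by simp
      _ ≤ _ := ContinuousLinearMap.le_opNorm _ _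
      _ ≤ (η * ‖t • v‖) * ‖v‖ := by gcongr
      _ ≤ (η * ‖v‖) * ‖v‖ := by
        gcongr
        rw [norm_smul, Real.norm_of_nonneg ht.1]
        exact mul_le_of_le_one_left (norm_nonneg _) ht.2.le
      _ = _ := by ring
  have := norm_image_sub_le_of_norm_deriv_le_segment' hder hbd 1 (by simp)
  simpa [hv] using this

/-- An immersion is locally bi-Lipschitz from below. -/
theorem HasStrictFDerivAt.exists_norm_sub_le {E F : Type*} [NormedAddCommGroup E]
    [NormedSpace ℝ E] [FiniteDimensional ℝ E] [NormedAddCommGroup F] [NormedSpace ℝ F]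
    {f : E → F} {f' : E →L[ℝ] F} {u₀ : E} (hf : HasStrictFDerivAt f f' u₀)
    (hinj : Function.Injective f') :
    ∃ κ : ℝ, 0 < κ ∧ ∀ᶠ q : E × E in 𝓝 (u₀, u₀), κ * ‖q.2 - q.1‖ ≤ ‖f q.2 - f q.1‖ := by
  obtain ⟨K, hK, hanti⟩ := (f' : E →ₗ[ℝ] F).injective_iff_antilipschitz.1 hinj
  have hK' : (0 : ℝ) < K := hK
  refine ⟨1 / (2 * K), by positivity, ?_⟩
  filter_upwards [hf.isLittleO.def (show 0 < 1 / (2 * (K : ℝ)) by positivity)] with q hq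
  have h1 := hanti.le_mul_dist (q.1 - q.2) 0
  simp only [dist_zero_right, map_zero, ContinuousLinearMap.coe_coe] at h1
  have h2 : ‖f' (q.1 - q.2)‖ ≤ ‖f q.1 - f q.2‖ + 1 / (2 * K) * ‖q.1 - q.2‖ := by
    calc _ = ‖(f q.1 - f q.2) - (f q.1 - f q.2 - f' (q.1 - q.2))‖ := by congr 1; abel
      _ ≤ _ := (norm_sub_le _ _).trans (by gcongr)
  rw [norm_sub_rev q.2, norm_sub_rev (f q.2)]
  have h3 : 1 / (K : ℝ) * ‖q.1 - q.2‖ ≤ ‖f' (q.1 - q.2)‖ := by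
    rw [one_div, inv_mul_le_iff₀ hK']; exact h1
  have h4 : 1 / (K : ℝ) = 1 / (2 * K) + 1 / (2 * K) := by field_simp; norm_num
  rw [h4] at h3
  linarith

/-! ### Gaussian integrals -/

/-- The integral of a centred Gaussian with precision matrix `H`, by the substitution `v ↦ B v` for
a factorization `H = Bᵀ B`. -/
theorem Matrix.PosDef.integral_exp_neg_half {n : ℕ} {H : Matrix (Fin n) (Fin n) ℝ}
    (hH : H.PosDef) :
    ∫ v : Euc n, Real.exp (-(1 / 2 * (v.ofLp ⬝ᵥ H.mulVec v.ofLp))) =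
      (2 * Real.pi) ^ ((n : ℝ) / 2) / Real.sqrt H.det := by
  obtain ⟨B, hB⟩ : ∃ B : Matrix (Fin n) (Fin n) ℝ, H = B.conjTranspose * B := by
    open scoped MatrixOrder in
    exact CStarAlgebra.nonneg_iff_eq_star_mul_self.1 hH.posSemidef.nonneg
  have hdet : H.det = B.det ^ 2 := by
    rw [hB, Matrix.det_mul, Matrix.det_conjTranspose, star_trivial, sq]
  have hdet0 : B.det ≠ 0 := by
    have := hH.det_pos
    rw [hdet] at this
    exact fun h => by simp [h] at this
  have hq : ∀ v : Euc n, v.ofLp ⬝ᵥ H.mulVec v.ofLp = ‖Matrix.toEuclideanLin B v‖ ^ 2 := by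
    intro v
    rw [hB, ← Matrix.mulVec_mulVec, Matrix.dotProduct_mulVec, Matrix.vecMul_conjTranspose,
      EuclideanSpace.real_norm_sq_eq]
    simp [dotProduct, sq]
  have hLdet : LinearMap.det (Matrix.toEuclideanLin B) = B.det := by
    change LinearMap.det (Matrix.toLpLin 2 2 B) = _
    rw [Matrix.toLpLin_eq_toLin, LinearMap.det_toLin]
  simp_rw [hq]
  have key := integral_map (μ := (volume : Measure (Euc n))) (φ := Matrix.toEuclideanLin B)
    (f := fun w : Euc n => Real.exp (-(1 / 2 * ‖w‖ ^ 2)))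
    (LinearMap.continuous_of_finiteDimensional _).aemeasurable
    (Continuous.aestronglyMeasurable (by fun_prop))
  rw [← key, Measure.map_linearMap_addHaar_eq_smul_addHaar _ (by rwa [hLdet]),
    integral_smul_measure, hLdet]
  have g := GaussianFourier.integral_rexp_neg_mul_sq_norm (V := Euc n) (b := 1 / 2) (by norm_num)
  simp only [← neg_mul] at g ⊢
  rw [g, hdet, Real.sqrt_sq_eq_abs, ENNReal.toReal_ofReal (abs_nonneg _), abs_inv,
    finrank_euclideanSpace_fin, smul_eq_mul, div_eq_inv_mul Real.pi, one_div, inv_inv,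
    ← div_eq_inv_mul]

/-! ### Nearest points -/

section NearestPoint

variable {n d : ℕ} {M : Set (Euc d)}

theorem LocalParam.contDiffAt (c : LocalParam n d M) {u : Euc n} (hu : u ∈ c.U) :
    ContDiffAt ℝ 4 c.Φ u :=
  c.contDiffOn.contDiffAt (c.isOpen_U.mem_nhds hu)

theorem LocalParam.hasStrictFDerivAt (c : LocalParam n d M) {u : Euc n} (hu : u ∈ c.U) :
    HasStrictFDerivAt c.Φ (fderiv ℝ c.Φ u) u :=
  (c.contDiffAt hu).hasStrictFDerivAt (by norm_num)

/-- The inverse of a local parametrization is continuous. -/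
theorem LocalParam.exists_ball_subset_image (c : LocalParam n d M) {u₀ : Euc n} (hu₀ : u₀ ∈ c.U)
    {W : Set (Euc n)} (hW : W ∈ 𝓝 u₀) :
    ∃ r : ℝ, 0 < r ∧ ∀ y ∈ M, ‖y - c.Φ u₀‖ < r → ∃ w ∈ W ∩ c.U, c.Φ w = y := by
  obtain ⟨V, hV, hVi⟩ := c.open_image (interior W ∩ c.U) Set.inter_subset_right
    (isOpen_interior.inter c.isOpen_U)
  have hmem : c.Φ u₀ ∈ V :=
    (hVi ▸ Set.mem_image_of_mem c.Φ ⟨mem_interior_iff_mem_nhds.2 hW, hu₀⟩ : _ ∈ M ∩ V).2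
  obtain ⟨r, hr, hball⟩ := Metric.isOpen_iff.1 hV _ hmem
  refine ⟨r, hr, fun y hy hyr => ?_⟩
  obtain ⟨w, hw, rfl⟩ : y ∈ c.Φ '' (interior W ∩ c.U) :=
    hVi ▸ ⟨hy, hball (by rwa [Metric.mem_ball, dist_eq_norm])⟩
  exact ⟨w, ⟨interior_subset hw.1, hw.2⟩, rfl⟩

theorem norm_sub_sq_sub_norm_sub_sq {E : Type*} [NormedAddCommGroup E] [InnerProductSpace ℝ E]
    (x y z : E) :
    ‖x - y‖ ^ 2 - ‖x - z‖ ^ 2 = ‖y - z‖ ^ 2 + 2 * inner ℝ (z - x) (y - z) := by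
  have h : x - y = -((z - x) + (y - z)) := by abel
  rw [h, norm_neg, norm_add_sq_real, norm_sub_rev x z]
  ring

/-- The displacement from a nearest point is normal to `M`. -/
theorem IsNearestPoint.inner_fderiv_eq_zero {c : LocalParam n d M} {x : Euc d} {u : Euc n}
    (hu : u ∈ c.U) (h : IsNearestPoint M x (c.Φ u)) (v : Euc n) :
    inner ℝ (c.Φ u - x) (fderiv ℝ c.Φ u v) = 0 := by
  have hmin : IsLocalMin (fun w => ‖c.Φ w - x‖ ^ 2) u := by
    filter_upwards [c.isOpen_U.mem_nhds hu] with w hw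
    have := h.2 _ (c.mapsTo hw)
    rw [norm_sub_rev, norm_sub_rev x] at this
    gcongr
  have hd : HasFDerivAt (fun w => c.Φ w - x) (fderiv ℝ c.Φ u) u :=
    (c.hasStrictFDerivAt hu).hasFDerivAt.sub_const x
  have h2 := hmin.hasFDerivAt_eq_zero hd.norm_sq
  have h3 := congrArg (fun L : Euc n →L[ℝ] ℝ => L v) h2
  simpa [inner_sub_left] using h3

theorem IsNearestPoint.exists (hM : IsCompact M) (hne : M.Nonempty) (x : Euc d) :
    ∃ y, IsNearestPoint M x y := by
  obtain ⟨y, hy, h⟩ := hM.exists_isMinOn hne (f := fun y => ‖x - y‖) (by fun_prop)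
  exact ⟨y, hy, fun z hz => h hz⟩

/-- Near a point of a parametrized patch, `M` deviates from its tangent spaces at most
quadratically; only the directions `x - P` for which `P` is a nearest point of `x` are tested. -/
theorem LocalParam.exists_eventually_inner_le (c : LocalParam n d M) {u₀ : Euc n}
    (hu₀ : u₀ ∈ c.U) :
    ∃ C : ℝ, ∀ᶠ P in 𝓝[M] (c.Φ u₀), ∀ x, IsNearestPoint M x P → ∀ y ∈ M,
      -inner ℝ (P - x) (y - P) ≤ C * ‖x - P‖ * ‖y - P‖ ^ 2 := by
  obtain ⟨κ, hκ, hbelow⟩ :=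
    (c.hasStrictFDerivAt hu₀).exists_norm_sub_le (c.immersion u₀ hu₀)
  have htaylor := ((c.contDiffAt hu₀).of_le (by norm_num)).taylor_two_eventually_le one_pos
  have hboth := hbelow.and htaylor
  rw [nhds_prod_eq] at hboth
  obtain ⟨s, hs, hs'⟩ := eventually_prod_self_iff'.1 hboth
  obtain ⟨r, hr, hrs⟩ := c.exists_ball_subset_image hu₀ hs
  set A := fderiv ℝ (fderiv ℝ c.Φ) u₀
  have hr2 : ∀ᶠ P in 𝓝[M] (c.Φ u₀), P ∈ Metric.ball (c.Φ u₀) (r / 2) :=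
    mem_nhdsWithin_of_mem_nhds (Metric.ball_mem_nhds _ (by positivity))
  refine ⟨max ((1 + ‖A‖) / κ ^ 2) (2 / r), ?_⟩
  filter_upwards [hr2, self_mem_nhdsWithin] with P hP hPM x hx y hy
  rw [Metric.mem_ball, dist_eq_norm] at hP
  have hcs : -inner ℝ (P - x) (y - P) ≤ ‖x - P‖ * ‖y - P‖ := by
    rw [← inner_neg_left, neg_sub]; exact real_inner_le_norm _ _
  rcases lt_or_ge ‖y - P‖ (r / 2) with hyP | hyP
  · -- both points lie in the patch
    obtain ⟨u, ⟨hus, huU⟩, rfl⟩ := hrs P hPM (by linarith)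
    obtain ⟨w, ⟨hws, -⟩, rfl⟩ := hrs y hy (by
      calc _ = ‖(y - c.Φ u) + (c.Φ u - c.Φ u₀)‖ := by congr 1; abel
        _ ≤ _ := norm_add_le _ _
        _ < r := by linarith)
    obtain ⟨h1, h2⟩ := hs' u hus w hws
    simp only at h1 h2
    have hrem : ‖c.Φ w - c.Φ u - fderiv ℝ c.Φ u (w - u)‖ ≤ (1 + ‖A‖) * ‖w - u‖ ^ 2 := by
      have h3 : ‖A (w - u) (w - u)‖ ≤ ‖A‖ * ‖w - u‖ * ‖w - u‖ := A.le_opNorm₂ _ _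
      have h4 := norm_sub_norm_le (c.Φ w - c.Φ u - fderiv ℝ c.Φ u (w - u))
        ((1 / 2 : ℝ) • A (w - u) (w - u))
      rw [norm_smul, Real.norm_of_nonneg (by norm_num : (0 : ℝ) ≤ 1 / 2)] at h4
      nlinarith [norm_nonneg (A (w - u) (w - u))]
    have h5 : ‖w - u‖ ^ 2 ≤ ‖c.Φ w - c.Φ u‖ ^ 2 / κ ^ 2 := by
      rw [le_div_iff₀ (by positivity), mul_comm, ← mul_pow]
      gcongr
    calc -inner ℝ (c.Φ u - x) (c.Φ w - c.Φ u)
        = inner ℝ (x - c.Φ u) (c.Φ w - c.Φ u - fderiv ℝ c.Φ u (w - u)) := by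
          rw [inner_sub_right _ _ (fderiv ℝ c.Φ u (w - u)), ← neg_sub (c.Φ u) x, inner_neg_left,
            inner_neg_left, hx.inner_fderiv_eq_zero huU]
          ring
      _ ≤ ‖x - c.Φ u‖ * ((1 + ‖A‖) * (‖c.Φ w - c.Φ u‖ ^ 2 / κ ^ 2)) :=
          (real_inner_le_norm _ _).trans (by gcongr; exact hrem.trans (by gcongr))
      _ = (1 + ‖A‖) / κ ^ 2 * ‖x - c.Φ u‖ * ‖c.Φ w - c.Φ u‖ ^ 2 := by ring
      _ ≤ _ := by gcongr; exact le_max_left _ _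
  · calc _ ≤ ‖x - P‖ * (1 * ‖y - P‖) := by rwa [one_mul]
      _ ≤ ‖x - P‖ * ((2 / r * ‖y - P‖) * ‖y - P‖) := by
          gcongr
          rw [div_mul_eq_mul_div, le_div_iff₀ hr]; linarith
      _ = 2 / r * ‖x - P‖ * ‖y - P‖ ^ 2 := by ring
      _ ≤ _ := by gcongr; exact le_max_right _ _

/-- A compact `C⁴` submanifold has positive reach, in a quantitative form. -/
theorem IsC4Submanifold.exists_growth (hMc : IsCompact M) (hM : IsC4Submanifold n d M) :
    ∃ ε : ℝ, 0 < ε ∧ ∀ x P, IsNearestPoint M x P → ‖x - P‖ ≤ ε → ∀ y ∈ M,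
      1 / 2 * ‖y - P‖ ^ 2 ≤ ‖x - y‖ ^ 2 - ‖x - P‖ ^ 2 := by
  obtain ⟨C, hC⟩ : ∃ C : ℝ, ∀ P ∈ M, ∀ x, IsNearestPoint M x P → ∀ y ∈ M,
      -inner ℝ (P - x) (y - P) ≤ C * ‖x - P‖ * ‖y - P‖ ^ 2 := by
    refine hMc.induction_on (p := fun S => ∃ C : ℝ, ∀ P ∈ S, ∀ x, IsNearestPoint M x P →
      ∀ y ∈ M, -inner ℝ (P - x) (y - P) ≤ C * ‖x - P‖ * ‖y - P‖ ^ 2) ?_ ?_ ?_ ?_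
    · exact ⟨0, by simp⟩
    · exact fun S T hST ⟨C, hC⟩ => ⟨C, fun P hP => hC P (hST hP)⟩
    · rintro S T ⟨C, hC⟩ ⟨C', hC'⟩
      refine ⟨max C C', ?_⟩
      rintro P (hP | hP) x hx y hy
      · exact (hC P hP x hx y hy).trans (by gcongr; exact le_max_left _ _)
      · exact (hC' P hP x hx y hy).trans (by gcongr; exact le_max_right _ _)
    · intro y hy
      obtain ⟨c, u₀, hu₀, rfl⟩ := hM y hy
      obtain ⟨C, hC⟩ := c.exists_eventually_inner_le hu₀
      exact ⟨_, hC, C, fun P hP => hP⟩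
  -- this `ε` makes `2 * C * ε ≤ 1 / 2`, which leaves half of `‖y - P‖ ^ 2` in the identity
  -- `‖x - y‖ ^ 2 - ‖x - P‖ ^ 2 = ‖y - P‖ ^ 2 + 2 * ⟪P - x, y - P⟫`
  refine ⟨1 / (4 * (|C| + 1)), by positivity, fun x P hP hx y hy => ?_⟩
  rw [norm_sub_sq_sub_norm_sub_sq]
  have h1 := hC P hP.1 x hP y hy
  have h2 : C * ‖x - P‖ ≤ 1 / 4 := by
    calc C * ‖x - P‖ ≤ (|C| + 1) * (1 / (4 * (|C| + 1))) := by
          gcongr; linarith [le_abs_self C]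
      _ = 1 / 4 := by field_simp
  nlinarith [mul_le_mul_of_nonneg_right h2 (sq_nonneg ‖y - P‖)]

/-! ### The Hessian of the squared distance -/

theorem LocalParam.hatH_apply (c : LocalParam n d M) {u : Euc n} (hu : u ∈ c.U) (x : Euc d)
    (i j : Fin n) :
    hatH c.Φ u x i j =
      inner ℝ (fderiv ℝ (fderiv ℝ c.Φ) u (EuclideanSpace.single i 1) (EuclideanSpace.single j 1))
        (c.Φ u - x) +
      inner ℝ (fderiv ℝ c.Φ u (EuclideanSpace.single i 1))
        (fderiv ℝ c.Φ u (EuclideanSpace.single j 1)) := by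
  have hdd : DifferentiableAt ℝ (fderiv ℝ c.Φ) u :=
    (((c.contDiffAt hu).fderiv_right (m := 1) (by norm_num))).differentiableAt (by norm_num)
  have hpp : partialD (partialD c.Φ j) i u =
      fderiv ℝ (fderiv ℝ c.Φ) u (EuclideanSpace.single i 1) (EuclideanSpace.single j 1) := by
    change fderiv ℝ (fun w => fderiv ℝ c.Φ w (EuclideanSpace.single j 1)) u _ = _
    rw [fderiv_clm_apply hdd (by fun_prop)]
    simp
  rw [← hpp]
  rfl

theorem LocalParam.dotProduct_hatH_mulVec (c : LocalParam n d M) {u : Euc n} (hu : u ∈ c.U)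
    (x : Euc d) (v : Euc n) :
    v.ofLp ⬝ᵥ (hatH c.Φ u x).mulVec v.ofLp =
      inner ℝ (c.Φ u - x) (fderiv ℝ (fderiv ℝ c.Φ) u v v) + ‖fderiv ℝ c.Φ u v‖ ^ 2 := by
  have hv : v = ∑ i, v i • EuclideanSpace.single i (1 : ℝ) := by
    ext j; simp [Pi.single_apply]
  rw [← real_inner_self_eq_norm_sq, real_inner_comm]
  conv_rhs => rw [hv]
  simp only [map_sum, map_smul, sum_apply, smul_apply, sum_inner, inner_sum, real_inner_smul_left,
    real_inner_smul_right, dotProduct, Matrix.mulVec, c.hatH_apply hu, Finset.mul_sum,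
    ← Finset.sum_add_distrib]
  rw [Finset.sum_comm]
  refine Finset.sum_congr rfl fun i _ => Finset.sum_congr rfl fun j _ => ?_
  rw [real_inner_comm (c.Φ u - x)]
  ring

theorem LocalParam.hatH_isHermitian (c : LocalParam n d M) {u : Euc n} (hu : u ∈ c.U)
    (x : Euc d) : (hatH c.Φ u x).IsHermitian := by
  ext i j
  have hs : IsSymmSndFDerivAt ℝ c.Φ u := (c.contDiffAt hu).isSymmSndFDerivAt
    (by rw [minSmoothness_of_isRCLikeNormedField]; norm_num)
  rw [Matrix.conjTranspose_apply, star_trivial, c.hatH_apply hu, c.hatH_apply hu, hs.eq,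
    real_inner_comm (fderiv ℝ c.Φ u _)]

/-- Second-order expansion of the squared distance to `x` along `M`, at scale `σ` around a nearest
point of `x`, jointly in the base point, the nearest point and the scale. -/
theorem LocalParam.tendsto_rescaled_dist_sq (c : LocalParam n d M) {ι : Type*} {l : Filter ι}
    {u₀ : Euc n} (hu₀ : u₀ ∈ c.U) {x₀ : Euc d} {u : ι → Euc n} {x : ι → Euc d} {σ : ι → ℝ}
    (hu : Tendsto u l (𝓝 u₀)) (hx : Tendsto x l (𝓝 x₀)) (hσ : Tendsto σ l (𝓝[>] 0))
    (hn : ∀ᶠ i in l, IsNearestPoint M (x i) (c.Φ (u i))) (v : Euc n) :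
    Tendsto (fun i => (‖x i - c.Φ (u i + σ i • v)‖ ^ 2 - ‖x i - c.Φ (u i)‖ ^ 2) / (2 * σ i ^ 2)) l
      (𝓝 (1 / 2 * (v.ofLp ⬝ᵥ (hatH c.Φ u₀ x₀).mulVec v.ofLp))) := by
  have hσ0 : Tendsto σ l (𝓝 0) := hσ.mono_right nhdsWithin_le_nhds
  have hσpos : ∀ᶠ i in l, 0 < σ i := hσ.eventually self_mem_nhdsWithin
  have hw : Tendsto (fun i => u i + σ i • v) l (𝓝 u₀) := by
    simpa using hu.add (hσ0.smul_const v)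
  have huU : ∀ᶠ i in l, u i ∈ c.U := hu.eventually (c.isOpen_U.mem_nhds hu₀)
  -- the second-order remainder
  set R : ι → Euc d := fun i =>
    (σ i ^ 2)⁻¹ • (c.Φ (u i + σ i • v) - c.Φ (u i) - fderiv ℝ c.Φ (u i) (σ i • v)) with hRdef
  have hR : Tendsto R l (𝓝 ((1 / 2 : ℝ) • fderiv ℝ (fderiv ℝ c.Φ) u₀ v v)) := by
    rw [Metric.tendsto_nhds]
    intro η hη
    have h1 := (hu.prodMk_nhds hw).eventually
      (((c.contDiffAt hu₀).of_le (by norm_num)).taylor_two_eventually_le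
        (show 0 < η / (‖v‖ ^ 2 + 1) by positivity))
    filter_upwards [h1, hσpos] with i hi hpos
    simp only [add_sub_cancel_left, map_smul, smul_apply, norm_smul,
      Real.norm_of_nonneg hpos.le] at hi
    rw [dist_eq_norm]
    have h2 : R i - (1 / 2 : ℝ) • fderiv ℝ (fderiv ℝ c.Φ) u₀ v v = (σ i ^ 2)⁻¹ •
        (c.Φ (u i + σ i • v) - c.Φ (u i) - σ i • fderiv ℝ c.Φ (u i) v -
          (1 / 2 : ℝ) • σ i • σ i • fderiv ℝ (fderiv ℝ c.Φ) u₀ v v) := by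
      simp only [hRdef]
      rw [smul_sub _ _ ((1 / 2 : ℝ) • _), map_smul]
      congr 1
      simp only [smul_smul]
      congr 1
      field_simp
    rw [h2, norm_smul, norm_inv, norm_pow, Real.norm_of_nonneg hpos.le,
      inv_mul_lt_iff₀ (by positivity)]
    refine hi.trans_lt ?_
    have h3 : ‖v‖ ^ 2 / (‖v‖ ^ 2 + 1) < 1 := by rw [div_lt_one (by positivity)]; linarith
    calc η / (‖v‖ ^ 2 + 1) * (σ i * ‖v‖) ^ 2 = (σ i ^ 2 * η) * (‖v‖ ^ 2 / (‖v‖ ^ 2 + 1)) := by ring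
      _ < (σ i ^ 2 * η) * 1 := by gcongr
      _ = _ := mul_one _
  have hD : Tendsto (fun i => fderiv ℝ c.Φ (u i) v) l (𝓝 (fderiv ℝ c.Φ u₀ v)) :=
    (((c.contDiffAt hu₀).continuousAt_fderiv (by norm_num)).clm_apply
      continuousAt_const).tendsto.comp hu
  have hΦ : Tendsto (fun i => c.Φ (u i)) l (𝓝 (c.Φ u₀)) :=
    (c.contDiffAt hu₀).continuousAt.tendsto.comp hu
  have hlim := ((((hσ0.smul hR).add hD).norm.pow 2).const_mul (1 / 2)).add
    ((hΦ.sub hx).inner (𝕜 := ℝ) hR)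
  rw [c.dotProduct_hatH_mulVec hu₀]
  convert hlim.congr' ?_ using 2
  · rw [zero_smul, zero_add, real_inner_smul_right]; ring
  · filter_upwards [hσpos, hn, huU] with i hpos hni hui
    rw [norm_sub_sq_sub_norm_sub_sq]
    have e1 : σ i • R i + fderiv ℝ c.Φ (u i) v =
        (σ i)⁻¹ • (c.Φ (u i + σ i • v) - c.Φ (u i)) := by
      simp only [hRdef, smul_smul, map_smul, smul_sub]
      have h1 : σ i * (σ i ^ 2)⁻¹ = (σ i)⁻¹ := by field_simp
      have h2 : σ i * ((σ i ^ 2)⁻¹ * σ i) = 1 := by field_simp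
      rw [h1, h2]
      module
    have e2 : inner ℝ (c.Φ (u i) - x i) (R i) =
        (σ i ^ 2)⁻¹ * inner ℝ (c.Φ (u i) - x i) (c.Φ (u i + σ i • v) - c.Φ (u i)) := by
      rw [hRdef, real_inner_smul_right, inner_sub_right _ _ (fderiv ℝ c.Φ (u i) _),
        hni.inner_fderiv_eq_zero hui, sub_zero]
    rw [e1, e2, norm_smul, norm_inv, Real.norm_of_nonneg hpos.le]
    field_simp

/-- If the squared distance to `x` grows quadratically on `M` away from `c.Φ u`, the matrix
`hatH` is positive definite there: along each ray of parameters the growth survives in the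
second-order limit. -/
theorem LocalParam.posDef_hatH (c : LocalParam n d M) {u : Euc n} (hu : u ∈ c.U) {x : Euc d}
    (hn : IsNearestPoint M x (c.Φ u))
    (hg : ∀ y ∈ M, 1 / 2 * ‖y - c.Φ u‖ ^ 2 ≤ ‖x - y‖ ^ 2 - ‖x - c.Φ u‖ ^ 2) :
    (hatH c.Φ u x).PosDef := by
  refine Matrix.PosDef.of_dotProduct_mulVec_pos (c.hatH_isHermitian hu x) fun v hv => ?_
  obtain ⟨κ, hκ, hbelow⟩ := (c.hasStrictFDerivAt hu).exists_norm_sub_le (c.immersion u hu)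
  have hlim := c.tendsto_rescaled_dist_sq (l := 𝓝[>] (0 : ℝ)) hu (u := fun _ => u)
    (x := fun _ => x) (σ := id) tendsto_const_nhds tendsto_const_nhds tendsto_id
    (Eventually.of_forall fun _ => hn) (WithLp.toLp 2 v)
  have hw : Tendsto (fun σ : ℝ => u + σ • WithLp.toLp 2 v) (𝓝[>] (0 : ℝ)) (𝓝 u) := by
    have : Tendsto (fun σ : ℝ => u + σ • WithLp.toLp 2 v) (𝓝 (0 : ℝ))
        (𝓝 (u + (0 : ℝ) • WithLp.toLp 2 v)) := Continuous.tendsto (by fun_prop) _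
    simpa using this.mono_left nhdsWithin_le_nhds
  have hle : κ ^ 2 * ‖WithLp.toLp 2 v‖ ^ 2 / 4 ≤
      1 / 2 * (v ⬝ᵥ (hatH c.Φ u x).mulVec v) := by
    refine ge_of_tendsto hlim ?_
    filter_upwards [(tendsto_const_nhds.prodMk_nhds hw).eventually hbelow, self_mem_nhdsWithin,
      hw.eventually (c.isOpen_U.mem_nhds hu)] with σ h1 (hσ : 0 < σ) hU
    have h2 := hg _ (c.mapsTo hU)
    simp only [add_sub_cancel_left, norm_smul, Real.norm_of_nonneg hσ.le] at h1
    have h3 : (κ * (σ * ‖WithLp.toLp 2 v‖)) ^ 2 ≤ ‖c.Φ (u + σ • WithLp.toLp 2 v) - c.Φ u‖ ^ 2 := by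
      gcongr
    simp only [id]
    rw [le_div_iff₀ (by positivity)]
    nlinarith
  have hv' : 0 < ‖WithLp.toLp 2 v‖ := by simpa using hv
  have : 0 < κ ^ 2 * ‖WithLp.toLp 2 v‖ ^ 2 / 4 := by positivity
  rw [star_trivial]
  linarith

end NearestPoint

/-! ### Integration in a local parametrization -/

section Integration

variable {n d : ℕ} {M : Set (Euc d)}

theorem LocalParam.measurableSet_image (c : LocalParam n d M) (hM : IsCompact M) {B : Set (Euc n)}
    (hB : IsOpen B) (hBU : B ⊆ c.U) : MeasurableSet (c.Φ '' B) := by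
  obtain ⟨V, hV, hVi⟩ := c.open_image B hBU hB
  rw [hVi]
  exact hM.measurableSet.inter hV.measurableSet

/-- On a patch, `μ` is the push-forward of its density; an equality of measures is what allows
integrals of functions to be transferred to the parameter domain. -/
theorem IsC1PosDensity.restrict_image_eq_map {μ : Measure (Euc d)} {c : LocalParam n d M}
    {p : Euc n → ℝ} (hp : IsC1PosDensity μ c p) {B : Set (Euc n)} (hB : IsOpen B)
    (hBU : B ⊆ c.U) :
    AEMeasurable c.Φ ((volume.restrict B).withDensity fun u => ENNReal.ofReal (p u)) ∧
    μ.restrict (c.Φ '' B) =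
      ((volume.restrict B).withDensity fun u => ENNReal.ofReal (p u)).map c.Φ := by
  have hmeas : AEMeasurable c.Φ ((volume.restrict B).withDensity fun u => ENNReal.ofReal (p u)) :=
    ((c.contDiffOn.continuousOn.mono hBU).aemeasurable hB.measurableSet).mono_ac
      (withDensity_absolutelyContinuous _ _)
  -- `c.Φ` is arbitrary outside `c.U`; its truncation to `B` is measurable everywhere
  have hΨ : Measurable (B.indicator c.Φ) := by
    classical
    rw [← Set.piecewise_eq_indicator]
    exact (c.contDiffOn.continuousOn.mono hBU).measurable_piecewise continuousOn_const
      hB.measurableSet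
  have hae : c.Φ =ᵐ[(volume.restrict B).withDensity fun u => ENNReal.ofReal (p u)]
      B.indicator c.Φ := by
    refine (withDensity_absolutelyContinuous _ _).ae_le ?_
    filter_upwards [ae_restrict_mem hB.measurableSet] with u hu
    rw [Set.indicator_of_mem hu]
  refine ⟨hmeas, ?_⟩
  rw [Measure.map_congr hae]
  ext T hT
  have himage : T ∩ c.Φ '' B = c.Φ '' (B.indicator c.Φ ⁻¹' T ∩ B) := by
    ext y
    constructor
    · rintro ⟨hy, u, hu, rfl⟩
      exact ⟨u, ⟨by simpa [Set.indicator_of_mem hu] using hy, hu⟩, rfl⟩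
    · rintro ⟨u, ⟨hu1, hu⟩, rfl⟩
      exact ⟨by simpa [Set.indicator_of_mem hu] using hu1, u, hu, rfl⟩
  rw [Measure.restrict_apply hT, Measure.map_apply hΨ hT, withDensity_apply _ (hΨ hT),
    Measure.restrict_restrict (hΨ hT), himage,
    hp.density _ (Set.inter_subset_right.trans hBU) ((hΨ hT).inter hB.measurableSet)]

theorem IsC1PosDensity.setIntegral_image {μ : Measure (Euc d)} {c : LocalParam n d M}
    {p : Euc n → ℝ} (hp : IsC1PosDensity μ c p) {B : Set (Euc n)} (hB : IsOpen B)
    (hBU : B ⊆ c.U) {g : Euc d → ℝ} (hg : Continuous g) :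
    ∫ y in c.Φ '' B, g y ∂μ = ∫ u in B, p u * g (c.Φ u) := by
  obtain ⟨h1, h2⟩ := hp.restrict_image_eq_map hB hBU
  rw [h2, integral_map h1 hg.aestronglyMeasurable,
    integral_withDensity_eq_integral_toReal_smul₀]
  · refine setIntegral_congr_fun hB.measurableSet fun u hu => ?_
    simp only [smul_eq_mul]
    rw [ENNReal.toReal_ofReal (hp.pos u (hBU hu)).le]
  · exact ((hp.contDiffOn.continuousOn.mono hBU).aemeasurable hB.measurableSet).ennreal_ofReal
  · exact Eventually.of_forall fun _ => ENNReal.ofReal_lt_top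

/-- Rescaling an integral by `σ` around the point `u`. -/
theorem integral_eq_rpow_mul_integral_comp_add_smul (f : Euc n → ℝ) (u : Euc n) {σ : ℝ}
    (hσ : 0 < σ) :
    (2 * Real.pi * σ ^ 2) ^ (-((n : ℝ) / 2)) * ∫ w, f w =
      (2 * Real.pi) ^ (-((n : ℝ) / 2)) * ∫ v, f (u + σ • v) := by
  have h1 := Measure.integral_comp_smul_of_nonneg (volume : Measure (Euc n)) (fun w => f (u + w)) σ
    (hR := hσ.le)
  rw [h1, integral_add_left_eq_self f u, finrank_euclideanSpace_fin, smul_eq_mul,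
    Real.mul_rpow (by positivity) (by positivity), ← Real.rpow_natCast σ 2,
    ← Real.rpow_mul hσ.le, mul_assoc]
  congr 2
  rw [← Real.rpow_natCast, ← Real.rpow_neg hσ.le]
  congr 1
  push_cast
  ring

end Integration

/-! ### Laplace's method -/

section Laplace

variable {n d : ℕ} {M : Set (Euc d)}

/-- The Gaussian kernel `exp (-‖x - γ y‖² / (2σ²))` divided by its value `exp (-‖x - z‖² / (2σ²))`
at a reference point `z` for `γ = 1`, in terms of `b = (1 - γ) / σ²`. -/
noncomputable def normalizedKernel (b σ : ℝ) (x z y : Euc d) : ℝ :=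
  Real.exp (-((‖x - y‖ ^ 2 - ‖x - z‖ ^ 2) / (2 * σ ^ 2)) - b * inner ℝ y (x - y)
    - b ^ 2 * σ ^ 2 * ‖y‖ ^ 2 / 2)

theorem continuous_normalizedKernel (b σ : ℝ) (x z : Euc d) :
    Continuous (normalizedKernel b σ x z) := by
  unfold normalizedKernel
  fun_prop

theorem normalizedKernel_pos (b σ : ℝ) (x z y : Euc d) : 0 < normalizedKernel b σ x z y :=
  Real.exp_pos _

theorem normalizedKernel_eq {σ : ℝ} (hσ : 0 < σ) (γ : ℝ) (x z y : Euc d) :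
    normalizedKernel ((1 - γ) / σ ^ 2) σ x z y =
      Real.exp (‖x - z‖ ^ 2 / (2 * σ ^ 2)) * Real.exp (-‖x - γ • y‖ ^ 2 / (2 * σ ^ 2)) := by
  have h : ‖x - γ • y‖ ^ 2 =
      ‖x - y‖ ^ 2 + 2 * (1 - γ) * inner ℝ y (x - y) + (1 - γ) ^ 2 * ‖y‖ ^ 2 := by
    have : x - γ • y = (x - y) + (1 - γ) • y := by module
    rw [this, norm_add_sq_real, real_inner_smul_right, real_inner_comm, norm_smul, mul_pow,
      Real.norm_eq_abs, sq_abs]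
    ring
  rw [normalizedKernel, ← Real.exp_add, h]
  congr 1
  field_simp
  ring

theorem normalizedKernel_le {b β R σ : ℝ} (hσ : 0 < σ) {x z y : Euc d} (hb : |b| ≤ β)
    (hR : ‖y‖ * ‖x - y‖ ≤ R)
    (hg : 1 / 2 * ‖y - z‖ ^ 2 ≤ ‖x - y‖ ^ 2 - ‖x - z‖ ^ 2) :
    normalizedKernel b σ x z y ≤ Real.exp (β * R) * Real.exp (-(‖y - z‖ ^ 2 / (4 * σ ^ 2))) := by
  rw [normalizedKernel, ← Real.exp_add]
  gcongr
  have h1 : ‖y - z‖ ^ 2 / (4 * σ ^ 2) ≤ (‖x - y‖ ^ 2 - ‖x - z‖ ^ 2) / (2 * σ ^ 2) := by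
    rw [div_le_div_iff₀ (by positivity) (by positivity)]
    nlinarith [mul_le_mul_of_nonneg_right hg (sq_nonneg σ)]
  have h2 : -(b * inner ℝ y (x - y)) ≤ β * R := by
    refine (neg_le_abs _).trans ?_
    rw [abs_mul]
    exact mul_le_mul hb ((abs_real_inner_le_norm _ _).trans hR) (abs_nonneg _)
      ((abs_nonneg _).trans hb)
  have h3 : 0 ≤ b ^ 2 * σ ^ 2 * ‖y‖ ^ 2 / 2 := by positivity
  linarith

/-- Quadratic growth makes the nearest-point projection continuous. -/
theorem tendsto_of_isNearestPoint {K : Set (Euc d)} {P : Euc d → Euc d}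
    (hP : ∀ x ∈ K, IsNearestPoint M x (P x))
    (hg : ∀ x ∈ K, ∀ y ∈ M, 1 / 2 * ‖y - P x‖ ^ 2 ≤ ‖x - y‖ ^ 2 - ‖x - P x‖ ^ 2)
    {x₀ : Euc d} (hx₀ : x₀ ∈ K) : Tendsto P (𝓝[K] x₀) (𝓝 (P x₀)) := by
  have hle : ∀ x ∈ K, ‖P x - P x₀‖ ^ 2 ≤
      2 * ((2 * ‖x - x₀‖ + ‖x₀ - P x₀‖) ^ 2 - ‖x₀ - P x₀‖ ^ 2) := by
    intro x hx
    have h1 := hg x₀ hx₀ (P x) (hP x hx).1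
    have h2 := (hP x hx).2 _ (hP x₀ hx₀).1
    have h3 : ‖x₀ - P x‖ ≤ 2 * ‖x - x₀‖ + ‖x₀ - P x₀‖ := by
      have h4 := norm_sub_le_norm_sub_add_norm_sub x₀ x (P x)
      have h5 := norm_sub_le_norm_sub_add_norm_sub x x₀ (P x₀)
      rw [norm_sub_rev x₀ x] at h4
      linarith
    have h6 : ‖x₀ - P x‖ ^ 2 ≤ (2 * ‖x - x₀‖ + ‖x₀ - P x₀‖) ^ 2 := by gcongr
    linarith
  rw [tendsto_iff_norm_sub_tendsto_zero]
  have hsq : Tendsto (fun x => ‖P x - P x₀‖ ^ 2) (𝓝[K] x₀) (𝓝 0) := by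
    have hc : Tendsto (fun x : Euc d =>
        2 * ((2 * ‖x - x₀‖ + ‖x₀ - P x₀‖) ^ 2 - ‖x₀ - P x₀‖ ^ 2)) (𝓝[K] x₀) (𝓝 0) := by
      have : Continuous fun x : Euc d =>
        2 * ((2 * ‖x - x₀‖ + ‖x₀ - P x₀‖) ^ 2 - ‖x₀ - P x₀‖ ^ 2) := by fun_prop
      simpa using (this.tendsto x₀).mono_left (nhdsWithin_le_nhds (s := K))
    exact squeeze_zero' (Eventually.of_forall fun _ => sq_nonneg _)
      (eventually_nhdsWithin_of_forall hle) hc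
  simpa [Real.sqrt_sq] using hsq.sqrt

theorem tendsto_rpow_neg_mul_exp_neg_div (s : ℝ) {c : ℝ} (hc : 0 < c) :
    Tendsto (fun σ : ℝ => (2 * Real.pi * σ ^ 2) ^ (-s) * Real.exp (-(c / σ ^ 2))) (𝓝[>] 0)
      (𝓝 0) := by
  have hinv : Tendsto (fun σ : ℝ => (σ ^ 2)⁻¹) (𝓝[>] 0) atTop := by
    refine tendsto_inv_nhdsGT_zero.comp ?_
    refine tendsto_nhdsWithin_iff.2 ⟨?_, ?_⟩
    · have : Tendsto (fun σ : ℝ => σ ^ 2) (𝓝 0) (𝓝 0) := by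
        simpa using (continuous_pow 2).tendsto (0 : ℝ)
      exact this.mono_left nhdsWithin_le_nhds
    · filter_upwards [self_mem_nhdsWithin] with σ (hσ : 0 < σ)
      exact pow_pos hσ 2
  have h := ((tendsto_rpow_mul_exp_neg_mul_atTop_nhds_zero s c hc).comp hinv).const_mul
    ((2 * Real.pi) ^ (-s))
  rw [mul_zero] at h
  refine h.congr' ?_
  filter_upwards [self_mem_nhdsWithin] with σ (hσ : 0 < σ)
  simp only [Function.comp]
  rw [Real.mul_rpow (x := 2 * Real.pi) (by positivity) (by positivity),
    Real.inv_rpow (by positivity),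
    ← Real.rpow_neg (by positivity), mul_assoc, div_eq_mul_inv, neg_mul]

/-- The part of the integral away from the nearest point is negligible. -/
theorem tendsto_rpow_mul_setIntegral_compl (hMc : IsCompact M) {K : Set (Euc d)}
    {P : Euc d → Euc d} (hP : ∀ x ∈ K, IsNearestPoint M x (P x))
    (hg : ∀ x ∈ K, ∀ y ∈ M, 1 / 2 * ‖y - P x‖ ^ 2 ≤ ‖x - y‖ ^ 2 - ‖x - P x‖ ^ 2)
    {μ : Measure (Euc d)} [IsProbabilityMeasure μ] (hμ : μ Mᶜ = 0)
    {b : ℝ → ℝ} {a : ℝ} (hb : Tendsto b (𝓝[>] 0) (𝓝 a)) {x₀ : Euc d} (hx₀ : x₀ ∈ K)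
    {S : Set (Euc d)} (hS : MeasurableSet S) {r : ℝ} (hr : 0 < r)
    (hSr : ∀ y ∈ M, ‖y - P x₀‖ < r → y ∈ S) (s : ℝ) :
    Tendsto (fun q : ℝ × Euc d => (2 * Real.pi * q.1 ^ 2) ^ (-s) *
      ∫ y in Sᶜ, normalizedKernel (b q.1) q.1 q.2 (P q.2) y ∂μ)
      (𝓝[>] 0 ×ˢ 𝓝[K] x₀) (𝓝 0) := by
  obtain ⟨R₀, hR₀⟩ := hMc.isBounded.exists_norm_le
  set R := R₀ * (‖x₀‖ + 1 + R₀) with hR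
  have hlim := ((tendsto_rpow_neg_mul_exp_neg_div s
    (show 0 < r ^ 2 / 16 by positivity)).comp (tendsto_fst (g := 𝓝[K] x₀))).mul_const
      (Real.exp ((|a| + 1) * R))
  rw [zero_mul] at hlim
  have hPt := tendsto_of_isNearestPoint hP hg hx₀
  have hbe : ∀ᶠ σ in 𝓝[>] (0 : ℝ), 0 < σ ∧ |b σ| ≤ |a| + 1 :=
    (eventually_mem_nhdsWithin).and (hb.abs.eventually (eventually_le_nhds (by linarith)))
  have hxe : ∀ᶠ x in 𝓝[K] x₀, x ∈ K ∧ ‖x‖ ≤ ‖x₀‖ + 1 ∧ ‖P x - P x₀‖ < r / 2 := by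
    refine eventually_mem_nhdsWithin.and (Eventually.and ?_ ?_)
    · exact (continuous_norm.tendsto x₀).mono_left nhdsWithin_le_nhds |>.eventually
        (eventually_le_nhds (by linarith))
    · simpa [dist_eq_norm] using hPt.eventually (Metric.ball_mem_nhds (P x₀) (half_pos hr))
  refine squeeze_zero_norm' ?_ hlim
  filter_upwards [hbe.prod_mk hxe] with ⟨σ, x⟩ ⟨⟨hσ, hbσ⟩, hxK, hx, hPx⟩
  simp only at hσ hbσ hxK hx hPx
  have hpow : 0 ≤ (2 * Real.pi * σ ^ 2) ^ (-s) := by positivity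
  simp only [Function.comp]
  rw [norm_mul, Real.norm_of_nonneg hpow, mul_assoc (_ ^ (-s))]
  gcongr
  have hbound : ∀ᵐ y ∂μ.restrict Sᶜ, ‖normalizedKernel (b σ) σ x (P x) y‖ ≤
      Real.exp (-(r ^ 2 / 16 / σ ^ 2)) * Real.exp ((|a| + 1) * R) := by
    have hMae : ∀ᵐ y ∂μ, y ∈ M := hμ
    filter_upwards [ae_restrict_mem hS.compl, ae_restrict_of_ae hMae] with y hyS hyM
    rw [Real.norm_of_nonneg (normalizedKernel_pos _ _ _ _ _).le]
    refine (normalizedKernel_le (R := R) hσ hbσ ?_ (hg x hxK y hyM)).trans ?_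
    · have := hR₀ y hyM
      have h2 := norm_sub_le x y
      rw [hR]
      gcongr
      · exact (norm_nonneg _).trans this
      · linarith
    · rw [mul_comm]
      refine mul_le_mul_of_nonneg_right (Real.exp_le_exp.2 (neg_le_neg ?_)) (Real.exp_pos _).le
      have h1 : r ≤ ‖y - P x₀‖ := not_lt.1 fun h => hyS (hSr y hyM h)
      have h2 := norm_sub_le_norm_sub_add_norm_sub y (P x) (P x₀)
      have h3 : r / 2 ≤ ‖y - P x‖ := by linarith
      have h4 : (r / 2) ^ 2 ≤ ‖y - P x‖ ^ 2 := by gcongr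
      rw [div_div, div_le_div_iff₀ (by positivity) (by positivity)]
      nlinarith [mul_le_mul_of_nonneg_right h4 (sq_nonneg σ)]
  refine (norm_integral_le_of_norm_le_const hbound).trans ?_
  exact mul_le_of_le_one_right (by positivity)
    (by rw [measureReal_restrict_apply_univ]; exact measureReal_le_one)

/-- The part of the integral near the nearest point, read in a parametrization and rescaled by `σ`,
converges to a Gaussian integral whose precision matrix is the Hessian of half the squared
distance. -/
theorem LocalParam.exists_tendsto_rpow_mul_setIntegral (c : LocalParam n d M) (hMc : IsCompact M)
    {K : Set (Euc d)} {P : Euc d → Euc d} (hP : ∀ x ∈ K, IsNearestPoint M x (P x))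
    (hg : ∀ x ∈ K, ∀ y ∈ M, 1 / 2 * ‖y - P x‖ ^ 2 ≤ ‖x - y‖ ^ 2 - ‖x - P x‖ ^ 2)
    {p : Euc n → ℝ} (hpc : ContinuousOn p c.U) (hpos : ∀ u ∈ c.U, 0 < p u)
    {b : ℝ → ℝ} {a : ℝ} (hb : Tendsto b (𝓝[>] 0) (𝓝 a)) {x₀ : Euc d} (hx₀ : x₀ ∈ K)
    {u₀ : Euc n} (hu₀ : u₀ ∈ c.U) (hΦ : c.Φ u₀ = P x₀) :
    ∃ B ⊆ c.U, IsOpen B ∧ u₀ ∈ B ∧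
      Tendsto (fun q : ℝ × Euc d => (2 * Real.pi * q.1 ^ 2) ^ (-((n : ℝ) / 2)) *
        ∫ w in B, p w * normalizedKernel (b q.1) q.1 q.2 (P q.2) (c.Φ w))
        (𝓝[>] 0 ×ˢ 𝓝[K] x₀)
        (𝓝 (p u₀ / Real.sqrt (hatH c.Φ u₀ x₀).det *
          Real.exp (-(a * inner ℝ (P x₀) (x₀ - P x₀))))) := by
  set l := 𝓝[>] (0 : ℝ) ×ˢ 𝓝[K] x₀ with hl
  obtain ⟨R₀, hR₀⟩ := hMc.isBounded.exists_norm_le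
  set R := R₀ * (‖x₀‖ + 1 + R₀) with hR
  -- a ball on which `c.Φ` is bi-Lipschitz from below and the density is bounded
  obtain ⟨κ, hκ, hbelow⟩ := (c.hasStrictFDerivAt hu₀).exists_norm_sub_le (c.immersion u₀ hu₀)
  rw [nhds_prod_eq] at hbelow
  obtain ⟨s, hs, hs'⟩ := eventually_prod_self_iff'.1 hbelow
  have hpcont : ContinuousAt p u₀ := hpc.continuousAt (c.isOpen_U.mem_nhds hu₀)
  obtain ⟨ρ, hρ, hball⟩ := Metric.eventually_nhds_iff_ball.1
    ((Filter.eventually_mem_set.2 hs).and ((c.isOpen_U.eventually_mem hu₀).and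
      (hpcont.eventually (eventually_le_nhds (show p u₀ < p u₀ + 1 by linarith)))))
  set B := Metric.ball u₀ ρ
  have hBo : IsOpen B := Metric.isOpen_ball
  have hBU : B ⊆ c.U := fun w hw => (hball w hw).2.1
  refine ⟨B, hBU, hBo, Metric.mem_ball_self hρ, ?_⟩
  -- the parameter of the nearest point
  set u : Euc d → Euc n := fun x => Function.invFunOn c.Φ c.U (P x) with hu_def
  have hPt := tendsto_of_isNearestPoint hP hg hx₀
  have hW : ∀ W ∈ 𝓝 u₀, ∀ᶠ x in 𝓝[K] x₀, u x ∈ W ∧ c.Φ (u x) = P x := by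
    intro W hW
    obtain ⟨r, hr, hrW⟩ := c.exists_ball_subset_image hu₀ hW
    have h1 : ∀ᶠ x in 𝓝[K] x₀, ‖P x - c.Φ u₀‖ < r := by
      simpa [dist_eq_norm, hΦ] using hPt.eventually (Metric.ball_mem_nhds (P x₀) hr)
    filter_upwards [h1, self_mem_nhdsWithin] with x hx hxK
    obtain ⟨w, hw, hwP⟩ := hrW _ (hP x hxK).1 hx
    have h2 : u x = w := by
      rw [hu_def]
      simp only [← hwP]
      exact c.injOn.leftInvOn_invFunOn hw.2
    rw [h2]
    exact ⟨hw.1, hwP⟩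
  have hut : Tendsto u (𝓝[K] x₀) (𝓝 u₀) := fun W hWn => (hW W hWn).mono fun x hx => hx.1
  have hσt : Tendsto (fun q : ℝ × Euc d => q.1) l (𝓝[>] 0) := tendsto_fst
  have hσ0 : Tendsto (fun q : ℝ × Euc d => q.1) l (𝓝 0) := hσt.mono_right nhdsWithin_le_nhds
  have hxt : Tendsto (fun q : ℝ × Euc d => q.2) l (𝓝 x₀) :=
    tendsto_snd.mono_right nhdsWithin_le_nhds
  have hut' : Tendsto (fun q : ℝ × Euc d => u q.2) l (𝓝 u₀) := hut.comp tendsto_snd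
  have hbt : Tendsto (fun q : ℝ × Euc d => b q.1) l (𝓝 a) := hb.comp tendsto_fst
  have hbe : ∀ᶠ σ in 𝓝[>] (0 : ℝ), 0 < σ ∧ |b σ| ≤ |a| + 1 :=
    (eventually_mem_nhdsWithin).and (hb.abs.eventually (eventually_le_nhds (by linarith)))
  have hxe : ∀ᶠ x in 𝓝[K] x₀, x ∈ K ∧ ‖x‖ ≤ ‖x₀‖ + 1 ∧ u x ∈ B ∧ c.Φ (u x) = P x :=
    eventually_mem_nhdsWithin.and (Eventually.and
      ((continuous_norm.tendsto x₀).mono_left nhdsWithin_le_nhds |>.eventually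
        (eventually_le_nhds (by linarith))) (hW B (Metric.ball_mem_nhds u₀ hρ)))
  have hev : ∀ᶠ q in l, (0 < q.1 ∧ |b q.1| ≤ |a| + 1) ∧
      q.2 ∈ K ∧ ‖q.2‖ ≤ ‖x₀‖ + 1 ∧ u q.2 ∈ B ∧ c.Φ (u q.2) = P q.2 := hbe.prod_mk hxe
  -- extended by zero, the integrand can be rescaled over the whole parameter space
  set f : ℝ × Euc d → Euc n → ℝ := fun q =>
    B.indicator fun w => p w * normalizedKernel (b q.1) q.1 q.2 (P q.2) (c.Φ w) with hf
  have hfmeas : ∀ q, Measurable (f q) := by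
    intro q
    have hcont : ContinuousOn
        (fun w => p w * normalizedKernel (b q.1) q.1 q.2 (P q.2) (c.Φ w)) B :=
      (hpc.mono hBU).mul ((continuous_normalizedKernel _ _ _ _).comp_continuousOn
        (c.contDiffOn.continuousOn.mono hBU))
    classical
    simp only [hf]
    rw [← Set.piecewise_eq_indicator]
    exact hcont.measurable_piecewise continuousOn_const hBo.measurableSet
  have hbound : ∀ᶠ q in l, ∀ᵐ v : Euc n, ‖f q (u q.2 + q.1 • v)‖ ≤
      (p u₀ + 1) * Real.exp ((|a| + 1) * R) * Real.exp (-(κ ^ 2 / 4) * ‖v‖ ^ 2) := by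
    filter_upwards [hev] with ⟨σ, x⟩ ⟨⟨hσ, hbσ⟩, hxK, hx, huB, huP⟩
    simp only at hσ hbσ hxK hx huB huP
    refine Eventually.of_forall fun v => ?_
    have hp0 := hpos u₀ hu₀
    by_cases hw : u x + σ • v ∈ B
    · simp only [hf, Set.indicator_of_mem hw]
      have hwU := hBU hw
      have hyM := c.mapsTo hwU
      rw [norm_mul, Real.norm_of_nonneg (hpos _ hwU).le,
        Real.norm_of_nonneg (normalizedKernel_pos _ _ _ _ _).le,
        mul_assoc]
      refine mul_le_mul (hball _ hw).2.2 ?_ (normalizedKernel_pos _ _ _ _ _).le (by positivity)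
      refine (normalizedKernel_le (R := R) hσ hbσ ?_ (hg x hxK _ hyM)).trans ?_
      · have h1 := hR₀ _ hyM
        have h2 := norm_sub_le x (c.Φ (u x + σ • v))
        rw [hR]
        gcongr
        · exact (norm_nonneg _).trans h1
        · linarith
      · gcongr
        have h3 := hs' _ (hball _ huB).1 _ (hball _ hw).1
        simp only [add_sub_cancel_left, norm_smul, Real.norm_of_nonneg hσ.le, huP] at h3
        have h4 : (κ * (σ * ‖v‖)) ^ 2 ≤ ‖c.Φ (u x + σ • v) - P x‖ ^ 2 := by gcongr
        rw [neg_mul, neg_le_neg_iff, le_div_iff₀ (by positivity)]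
        nlinarith
    · simp only [hf, Set.indicator_of_notMem hw, norm_zero]
      positivity
  have hint : Integrable (fun v : Euc n =>
      (p u₀ + 1) * Real.exp ((|a| + 1) * R) * Real.exp (-(κ ^ 2 / 4) * ‖v‖ ^ 2)) := by
    refine Integrable.const_mul ?_ _
    have h := GaussianFourier.integrable_cexp_neg_mul_sq_norm_add (V := Euc n)
      (b := ((κ ^ 2 / 4 : ℝ) : ℂ)) (by rw [Complex.ofReal_re]; positivity) 0 0
    refine h.norm.congr (Eventually.of_forall fun v => ?_)
    simp only [zero_mul, add_zero, Complex.norm_exp]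
    norm_cast
  have hpt : ∀ v : Euc n, Tendsto (fun q => f q (u q.2 + q.1 • v)) l
      (𝓝 (p u₀ * Real.exp (-(a * inner ℝ (P x₀) (x₀ - P x₀))) *
        Real.exp (-(1 / 2 * (v.ofLp ⬝ᵥ (hatH c.Φ u₀ x₀).mulVec v.ofLp))))) := by
    intro v
    have hw : Tendsto (fun q : ℝ × Euc d => u q.2 + q.1 • v) l (𝓝 u₀) := by
      simpa using hut'.add (hσ0.smul_const v)
    have hΦw : Tendsto (fun q : ℝ × Euc d => c.Φ (u q.2 + q.1 • v)) l (𝓝 (P x₀)) := by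
      rw [← hΦ]
      exact (c.contDiffAt hu₀).continuousAt.tendsto.comp hw
    have h1 := c.tendsto_rescaled_dist_sq hu₀ hut' hxt hσt (by
      filter_upwards [hev] with q hq
      rw [hq.2.2.2.2]
      exact hP _ hq.2.1) v
    have h2 := hbt.mul (hΦw.inner (𝕜 := ℝ) (hxt.sub hΦw))
    have h3 := (((hbt.pow 2).mul (hσ0.pow 2)).mul (hΦw.norm.pow 2)).div_const 2
    have h4 := (hpcont.tendsto.comp hw).mul
      ((Real.continuous_exp.tendsto _).comp ((h1.neg.sub h2).sub h3))
    convert h4.congr' ?_ using 2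
    · rw [mul_assoc, ← Real.exp_add]
      congr 2
      ring
    · filter_upwards [hev, hw.eventually (hBo.mem_nhds (Metric.mem_ball_self hρ))] with q hq hqB
      replace hqB : u q.2 + q.1 • v ∈ B := hqB
      simp only [hf, Set.indicator_of_mem hqB, normalizedKernel, Function.comp, ← hq.2.2.2.2]
  have hdct := (tendsto_integral_filter_of_dominated_convergence _
    (Eventually.of_forall fun q => ((hfmeas q).comp (by fun_prop)).aestronglyMeasurable)
    hbound hint (Eventually.of_forall hpt)).const_mul ((2 * Real.pi) ^ (-((n : ℝ) / 2)))
  have hpd : (hatH c.Φ u₀ x₀).PosDef := by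
    refine c.posDef_hatH hu₀ ?_ ?_
    · rw [hΦ]; exact hP x₀ hx₀
    · rw [hΦ]; exact hg x₀ hx₀
  rw [integral_const_mul, hpd.integral_exp_neg_half] at hdct
  convert hdct.congr' ?_ using 2
  · rw [Real.rpow_neg (by positivity)]
    field_simp
  · filter_upwards [hev] with q hq
    simp only [Function.comp]
    rw [← integral_eq_rpow_mul_integral_comp_add_smul _ _ hq.1.1,
      integral_indicator hBo.measurableSet]

/-- Laplace's method, jointly in the scale `σ` and the point `x`. -/
theorem LocalParam.tendsto_smoothedDensity (c : LocalParam n d M) (hMc : IsCompact M)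
    {K : Set (Euc d)} {P : Euc d → Euc d} (hP : ∀ x ∈ K, IsNearestPoint M x (P x))
    (hg : ∀ x ∈ K, ∀ y ∈ M, 1 / 2 * ‖y - P x‖ ^ 2 ≤ ‖x - y‖ ^ 2 - ‖x - P x‖ ^ 2)
    {μ : Measure (Euc d)} [IsProbabilityMeasure μ] (hμ : μ Mᶜ = 0)
    {p : Euc n → ℝ} (hp : IsC1PosDensity μ c p)
    {γ : ℝ → ℝ} {a : ℝ} (hγ : Tendsto (fun σ => (1 - γ σ) / σ ^ 2) (𝓝[>] 0) (𝓝 a))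
    {x₀ : Euc d} (hx₀ : x₀ ∈ K) {u₀ : Euc n} (hu₀ : u₀ ∈ c.U) (hΦ : c.Φ u₀ = P x₀) :
    Tendsto (fun q : ℝ × Euc d => (2 * Real.pi * q.1 ^ 2) ^ (((d : ℝ) - n) / 2) *
        Real.exp (‖q.2 - P q.2‖ ^ 2 / (2 * q.1 ^ 2)) * smoothedDensity μ (γ q.1) q.1 q.2)
      (𝓝[>] 0 ×ˢ 𝓝[K] x₀)
      (𝓝 (p u₀ / Real.sqrt (hatH c.Φ u₀ x₀).det *
        Real.exp (-(a * inner ℝ (P x₀) (x₀ - P x₀))))) := by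
  obtain ⟨B, hBU, hBo, huB, hlim⟩ := c.exists_tendsto_rpow_mul_setIntegral hMc hP hg
    hp.contDiffOn.continuousOn hp.pos hγ hx₀ hu₀ hΦ
  obtain ⟨r, hr, hrB⟩ := c.exists_ball_subset_image hu₀ (hBo.mem_nhds huB)
  have hS := c.measurableSet_image hMc hBo hBU
  have hout := tendsto_rpow_mul_setIntegral_compl hMc hP hg hμ hγ hx₀ hS hr
    (fun y hy hyr => by
      obtain ⟨w, hw, hwy⟩ := hrB y hy (by rwa [hΦ])
      exact ⟨w, hw.1, hwy⟩) ((n : ℝ) / 2)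
  have hsum := hlim.add hout
  rw [add_zero] at hsum
  refine hsum.congr' ?_
  have hev : ∀ᶠ q : ℝ × Euc d in 𝓝[>] (0 : ℝ) ×ˢ 𝓝[K] x₀, 0 < q.1 ∧ q.2 ∈ K :=
    eventually_mem_nhdsWithin.prod_mk eventually_mem_nhdsWithin
  filter_upwards [hev] with ⟨σ, x⟩ ⟨hσ, hx⟩
  simp only at hσ hx ⊢
  have hint : Integrable (normalizedKernel ((1 - γ σ) / σ ^ 2) σ x (P x)) μ := by
    refine Integrable.of_bound (continuous_normalizedKernel _ _ _ _).aestronglyMeasurable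
      (Real.exp (‖x - P x‖ ^ 2 / (2 * σ ^ 2))) (Eventually.of_forall fun y => ?_)
    rw [Real.norm_of_nonneg (normalizedKernel_pos _ _ _ _ _).le, normalizedKernel_eq hσ]
    refine mul_le_of_le_one_right (Real.exp_pos _).le (Real.exp_le_one_iff.2 ?_)
    rw [neg_div, neg_nonpos]
    positivity
  rw [← hp.setIntegral_image hBo hBU (continuous_normalizedKernel _ _ _ _), ← mul_add,
    integral_add_compl hS hint, smoothedDensity]
  simp_rw [normalizedKernel_eq hσ]
  rw [integral_const_mul, integral_const_mul]
  have hpow : (2 * Real.pi * σ ^ 2) ^ (-((n : ℝ) / 2)) =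
      (2 * Real.pi * σ ^ 2) ^ (((d : ℝ) - n) / 2) *
        (1 / (2 * Real.pi * σ ^ 2) ^ ((d : ℝ) / 2)) := by
    rw [one_div, ← Real.rpow_neg (by positivity), ← Real.rpow_add (by positivity)]
    congr 1
    ring
  rw [hpow]
  ring

end Laplace

/-! ### Uniformity -/

/-- Convergence of `F (σ, x)` to a positive limit, jointly in `σ → 0⁺` and in `x` near each point of
a compact set, makes the logarithms converge uniformly on that set. -/
theorem IsCompact.eventually_forall_abs_log_sub_lt {X : Type*} [TopologicalSpace X] {K : Set X}
    (hK : IsCompact K) {F : ℝ × X → ℝ} {G : X → ℝ} (hG : ∀ x ∈ K, 0 < G x)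
    (hF : ∀ x ∈ K, Tendsto F (𝓝[>] 0 ×ˢ 𝓝[K] x) (𝓝 (G x))) {δ : ℝ} (hδ : 0 < δ) :
    ∀ᶠ σ in 𝓝[>] (0 : ℝ), ∀ x ∈ K,
      0 < F (σ, x) ∧ |Real.log (F (σ, x)) - Real.log (G x)| < δ := by
  suffices h : ∀ᶠ σ in 𝓝[>] (0 : ℝ), ∀ x ∈ K, x ∈ K →
      0 < F (σ, x) ∧ |Real.log (F (σ, x)) - Real.log (G x)| < δ from
    h.mono fun σ hσ x hx => hσ x hx hx
  refine hK.induction_on (p := fun S => ∀ᶠ σ in 𝓝[>] (0 : ℝ), ∀ x ∈ S, x ∈ K →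
      0 < F (σ, x) ∧ |Real.log (F (σ, x)) - Real.log (G x)| < δ) ?_ ?_ ?_ ?_
  · simp
  · exact fun S T hST h => h.mono fun σ hσ x hx => hσ x (hST hx)
  · intro S T hS hT
    filter_upwards [hS, hT] with σ h1 h2
    rintro x (hx | hx)
    exacts [h1 x hx, h2 x hx]
  · intro x₀ hx₀
    have hlog := ((hF x₀ hx₀).log (hG x₀ hx₀).ne').eventually
      (Metric.ball_mem_nhds _ (half_pos hδ))
    have hpos := (hF x₀ hx₀).eventually (eventually_gt_nhds (hG x₀ hx₀))
    obtain ⟨pa, hpa, pb, hpb, hab⟩ := eventually_prod_iff.1 (hpos.and hlog)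
    refine ⟨{x | pb x}, hpb, ?_⟩
    filter_upwards [hpa] with σ hσ x hx hxK
    obtain ⟨h1, h2⟩ := hab hσ hx
    refine ⟨h1, ?_⟩
    rw [Real.dist_eq] at h2
    -- the limit at `x` is approached by values close to the limit at `x₀`
    have h3 : Tendsto (fun τ => |Real.log (F (τ, x)) - Real.log (G x₀)|) (𝓝[>] (0 : ℝ))
        (𝓝 |Real.log (G x) - Real.log (G x₀)|) := by
      have hsl : Tendsto (fun τ : ℝ => (τ, x)) (𝓝[>] 0) (𝓝[>] 0 ×ˢ 𝓝[K] x) :=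
        tendsto_id.prodMk (tendsto_const_pure.mono_right (pure_le_nhdsWithin hxK))
      exact ((((hF x hxK).comp hsl).log (hG x hxK).ne').sub_const _).abs
    have h4 : |Real.log (G x) - Real.log (G x₀)| ≤ δ / 2 := by
      refine le_of_tendsto h3 ?_
      filter_upwards [hpa] with τ hτ
      have := (hab hτ hx).2
      rw [Real.dist_eq] at this
      exact this.le
    rw [abs_sub_comm] at h4
    calc _ ≤ |Real.log (F (σ, x)) - Real.log (G x₀)| + |Real.log (G x₀) - Real.log (G x)| :=
          abs_sub_le _ _ _
      _ < δ := by linarith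

/-- The expansion for a general contraction factor `γ σ = 1 - a σ² + o(σ²)`. -/
theorem eventually_abs_log_smoothedDensity_sub_lt {n d : ℕ} {M : Set (Euc d)} (hMc : IsCompact M)
    {K : Set (Euc d)} (hK : IsCompact K) {P : Euc d → Euc d}
    (hP : ∀ x ∈ K, IsNearestPoint M x (P x))
    (hg : ∀ x ∈ K, ∀ y ∈ M, 1 / 2 * ‖y - P x‖ ^ 2 ≤ ‖x - y‖ ^ 2 - ‖x - P x‖ ^ 2)
    (huniq : ∀ x ∈ K, ∀ y, IsNearestPoint M x y → y = P x)
    {μ : Measure (Euc d)} [IsProbabilityMeasure μ] (hμ : μ Mᶜ = 0)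
    {A : Set (LocalParam n d M)} (hA : IsAtlas A) {p : LocalParam n d M → Euc n → ℝ}
    (hp : ∀ c ∈ A, IsC1PosDensity μ c (p c))
    {γ : ℝ → ℝ} {a : ℝ} (hγ : Tendsto (fun σ => (1 - γ σ) / σ ^ 2) (𝓝[>] 0) (𝓝 a))
    {δ : ℝ} (hδ : 0 < δ) :
    ∀ᶠ σ in 𝓝[>] (0 : ℝ), ∀ x ∈ K,
      0 < smoothedDensity μ (γ σ) σ x ∧
      ∀ c ∈ A, ∀ u ∈ c.U, IsNearestPoint M x (c.Φ u) →
        |Real.log (smoothedDensity μ (γ σ) σ x) -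
          (-(1 / (2 * σ ^ 2)) * ‖x - c.Φ u‖ ^ 2 + Real.log (p c u)
            - ((d : ℝ) - (n : ℝ)) / 2 * Real.log (2 * Real.pi * σ ^ 2)
            - Real.log (Real.sqrt |(hatH c.Φ u x).det|)
            - a * inner ℝ (c.Φ u) (x - c.Φ u))| < δ := by
  have hchart : ∀ x : Euc d, ∃ G : ℝ, x ∈ K → ∃ c ∈ A, ∃ u ∈ c.U, c.Φ u = P x ∧
      G = p c u / Real.sqrt (hatH c.Φ u x).det * Real.exp (-(a * inner ℝ (P x) (x - P x))) := by
    intro x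
    by_cases hx : x ∈ K
    · obtain ⟨c, hc, u, hu, huP⟩ := hA (P x) (hP x hx).1
      exact ⟨_, fun _ => ⟨c, hc, u, hu, huP, rfl⟩⟩
    · exact ⟨0, fun h => absurd h hx⟩
  choose G hG using hchart
  set F : ℝ × Euc d → ℝ := fun q => (2 * Real.pi * q.1 ^ 2) ^ (((d : ℝ) - n) / 2) *
    Real.exp (‖q.2 - P q.2‖ ^ 2 / (2 * q.1 ^ 2)) * smoothedDensity μ (γ q.1) q.1 q.2 with hFdef
  -- `F` is the density with all divergent factors removed
  have hlim : ∀ x ∈ K, ∀ c ∈ A, ∀ u ∈ c.U, c.Φ u = P x →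
      Tendsto F (𝓝[>] 0 ×ˢ 𝓝[K] x) (𝓝 (p c u / Real.sqrt (hatH c.Φ u x).det *
        Real.exp (-(a * inner ℝ (P x) (x - P x))))) :=
    fun x hx c hc u hu huP => c.tendsto_smoothedDensity hMc hP hg hμ (hp c hc) hγ hx hu huP
  have hdet : ∀ x ∈ K, ∀ c ∈ A, ∀ u ∈ c.U, c.Φ u = P x → 0 < (hatH c.Φ u x).det := by
    intro x hx c hc u hu huP
    refine (c.posDef_hatH hu ?_ ?_).det_pos
    · rw [huP]; exact hP x hx
    · rw [huP]; exact hg x hx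
  have hFG : ∀ x ∈ K, Tendsto F (𝓝[>] 0 ×ˢ 𝓝[K] x) (𝓝 (G x)) := by
    intro x hx
    obtain ⟨c, hc, u, hu, huP, hGx⟩ := hG x hx
    rw [hGx]
    exact hlim x hx c hc u hu huP
  have hGpos : ∀ x ∈ K, 0 < G x := by
    intro x hx
    obtain ⟨c, hc, u, hu, huP, hGx⟩ := hG x hx
    rw [hGx]
    have h1 := hdet x hx c hc u hu huP
    have h2 := (hp c hc).pos u hu
    positivity
  filter_upwards [hK.eventually_forall_abs_log_sub_lt hGpos hFG hδ, self_mem_nhdsWithin]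
    with σ hσ (hσ0 : 0 < σ) x hx
  obtain ⟨h1, h2⟩ := hσ x hx
  have hpow : 0 < (2 * Real.pi * σ ^ 2) ^ (((d : ℝ) - n) / 2) := by positivity
  have hdens : 0 < smoothedDensity μ (γ σ) σ x := by
    simp only [hFdef] at h1
    exact pos_of_mul_pos_right h1 (by positivity)
  refine ⟨hdens, fun c hc u hu hn => ?_⟩
  have huP := huniq x hx _ hn
  -- the limit does not depend on the parametrization
  have hGx : G x = p c u / Real.sqrt (hatH c.Φ u x).det *
      Real.exp (-(a * inner ℝ (P x) (x - P x))) := by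
    have : (𝓝[K] x).NeBot := mem_closure_iff_nhdsWithin_neBot.1 (subset_closure hx)
    exact tendsto_nhds_unique (hFG x hx) (hlim x hx c hc u hu huP)
  have hd := hdet x hx c hc u hu huP
  have hpp := (hp c hc).pos u hu
  have hs : 0 < Real.sqrt (hatH c.Φ u x).det := Real.sqrt_pos.2 hd
  rw [hGx, Real.log_mul (by positivity) (Real.exp_pos _).ne', Real.log_div hpp.ne' hs.ne',
    Real.log_exp, hFdef] at h2
  simp only at h2
  rw [Real.log_mul (by positivity) hdens.ne', Real.log_mul hpow.ne' (Real.exp_pos _).ne',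
    Real.log_exp, Real.log_rpow (by positivity)] at h2
  rw [huP, abs_of_pos hd]
  convert h2 using 2
  ring

theorem tendsto_one_sub_sqrt_one_sub_sq_div_sq :
    Tendsto (fun σ : ℝ => (1 - Real.sqrt (1 - σ ^ 2)) / σ ^ 2) (𝓝[>] 0) (𝓝 (1 / 2)) := by
  have hc : Tendsto (fun σ : ℝ => 1 / (1 + Real.sqrt (1 - σ ^ 2))) (𝓝[>] 0) (𝓝 (1 / 2)) := by
    have hcont : Continuous fun σ : ℝ => 1 / (1 + Real.sqrt (1 - σ ^ 2)) :=
      continuous_const.div (by fun_prop) fun σ => by positivity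
    have := (hcont.tendsto 0).mono_left (nhdsWithin_le_nhds (s := Set.Ioi 0))
    norm_num at this ⊢
    exact this
  refine hc.congr' ?_
  filter_upwards [Ioo_mem_nhdsGT (zero_lt_one' ℝ)] with σ ⟨h0, h1⟩
  have hs : Real.sqrt (1 - σ ^ 2) ^ 2 = 1 - σ ^ 2 := Real.sq_sqrt (by nlinarith)
  have hpos : 0 < 1 + Real.sqrt (1 - σ ^ 2) := by positivity
  rw [div_eq_div_iff hpos.ne' (by positivity)]
  linear_combination hs

theorem mainTheorem1 (n d : ℕ) (M : Set (Euc d)) (hMc : IsCompact M)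
    (hM : IsC4Submanifold n d M) :
    ∃ ε : ℝ, 0 < ε ∧
      (∀ x ∈ Metric.thickening ε M, ∃! y, IsNearestPoint M x y) ∧
      (∀ x ∈ Metric.thickening ε M, ∀ c : LocalParam n d M, ∀ u ∈ c.U,
        IsNearestPoint M x (c.Φ u) → 0 < (hatH c.Φ u x).det) ∧
      ∀ (μ : Measure (Euc d)) [IsProbabilityMeasure μ], μ Mᶜ = 0 →
      ∀ (A : Set (LocalParam n d M)), IsAtlas A →
      ∀ (p : LocalParam n d M → Euc n → ℝ), (∀ c ∈ A, IsC1PosDensity μ c (p c)) →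
        (∀ δ : ℝ, 0 < δ → ∀ᶠ σ in 𝓝[>] (0 : ℝ), ∀ x ∈ Metric.thickening ε M,
          0 < densityVE μ σ x ∧
          ∀ c ∈ A, ∀ u ∈ c.U, IsNearestPoint M x (c.Φ u) →
            |Real.log (densityVE μ σ x) -
              (-(1 / (2 * σ ^ 2)) * ‖x - c.Φ u‖ ^ 2 + Real.log (p c u)
                - ((d : ℝ) - (n : ℝ)) / 2 * Real.log (2 * Real.pi * σ ^ 2)
                - Real.log (Real.sqrt |(hatH c.Φ u x).det|))| < δ) ∧
        (∀ δ : ℝ, 0 < δ → ∀ᶠ σ in 𝓝[>] (0 : ℝ), ∀ x ∈ Metric.thickening ε M,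
          0 < densityVP μ σ x ∧
          ∀ c ∈ A, ∀ u ∈ c.U, IsNearestPoint M x (c.Φ u) →
            |Real.log (densityVP μ σ x) -
              (-(1 / (2 * σ ^ 2)) * ‖x - c.Φ u‖ ^ 2 + Real.log (p c u)
                - ((d : ℝ) - (n : ℝ)) / 2 * Real.log (2 * Real.pi * σ ^ 2)
                - Real.log (Real.sqrt |(hatH c.Φ u x).det|)
                - 1 / 2 * inner ℝ (c.Φ u) (x - c.Φ u))| < δ) := by
  obtain ⟨ε, hε, hgrowth⟩ := hM.exists_growth hMc
  set K := Metric.cthickening ε M with hKdef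
  have hK : IsCompact K := hMc.cthickening
  have hTK : Metric.thickening ε M ⊆ K := Metric.thickening_subset_cthickening ε M
  have hmem : ∀ x ∈ K, ∃ z ∈ M, ‖x - z‖ ≤ ε := by
    intro x hx
    rw [hKdef, hMc.cthickening_eq_biUnion_closedBall hε.le] at hx
    simpa [dist_eq_norm] using hx
  have hex : ∀ x : Euc d, ∃ y, x ∈ K → IsNearestPoint M x y := by
    intro x
    by_cases hx : x ∈ K
    · obtain ⟨z, hz, -⟩ := hmem x hx
      obtain ⟨y, hy⟩ := IsNearestPoint.exists hMc ⟨z, hz⟩ x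
      exact ⟨y, fun _ => hy⟩
    · exact ⟨x, fun h => absurd h hx⟩
  choose P hP using hex
  have hg : ∀ x ∈ K, ∀ z, IsNearestPoint M x z → ∀ y ∈ M,
      1 / 2 * ‖y - z‖ ^ 2 ≤ ‖x - y‖ ^ 2 - ‖x - z‖ ^ 2 := by
    intro x hx z hz
    obtain ⟨z', hz', hle⟩ := hmem x hx
    exact hgrowth x z hz ((hz.2 z' hz').trans hle)
  have huniq : ∀ x ∈ K, ∀ y, IsNearestPoint M x y → y = P x := by
    intro x hx y hy
    have h1 := hg x hx _ (hP x hx) y hy.1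
    have h2 := hy.2 _ (hP x hx).1
    have h3 : ‖x - y‖ ^ 2 ≤ ‖x - P x‖ ^ 2 := by gcongr
    have h4 : ‖y - P x‖ ^ 2 = 0 := le_antisymm (by linarith) (sq_nonneg _)
    exact sub_eq_zero.1 (norm_eq_zero.1 (pow_eq_zero_iff two_ne_zero |>.1 h4))
  refine ⟨ε, hε, fun x hx => ⟨P x, hP x (hTK hx), huniq x (hTK hx)⟩,
    fun x hx c u hu hn => (c.posDef_hatH hu hn (hg x (hTK hx) _ hn)).det_pos, ?_⟩
  intro μ _ hμ A hA p hp
  refine ⟨fun δ hδ => ?_, fun δ hδ => ?_⟩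
  · have hγ : Tendsto (fun σ : ℝ => (1 - (1 : ℝ)) / σ ^ 2) (𝓝[>] 0) (𝓝 0) := by simp
    filter_upwards [eventually_abs_log_smoothedDensity_sub_lt hMc hK hP
      (fun x hx => hg x hx _ (hP x hx)) huniq hμ hA hp hγ hδ] with σ hσ x hx
    simpa only [densityVE, zero_mul, sub_zero] using hσ x (hTK hx)
  · filter_upwards [eventually_abs_log_smoothedDensity_sub_lt hMc hK hP
      (fun x hx => hg x hx _ (hP x hx)) huniq hμ hA hp tendsto_one_sub_sqrt_one_sub_sq_div_sq hδ]
      with σ hσ x hx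
    exact hσ x (hTK hx)
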